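/- Let $n\ge 2$, let $X$ be a smooth $n$-dimensional manifold (Hausdorff, second countable) with a smooth Riemannian metric $g$, volume element $dV$ and gradient $\nabla_g$, and let $\theta: X\times S^{n-1}\to\mathbb R$ be smooth, where $S^{n-1}$ is the unit sphere of $\mathbb R^n$. Put $\Sigma=\mathbb R\times S^{n-1}$, $\Phi(x;\lambda,\omega)=\theta(x,\omega)-\lambda$ on $X\times\Sigma$, $Z=\{\Phi=0\}\subset X\times\Sigma$ and $Z(\lambda,\omega)=\{x\in X:\theta(x,\omega)=\lambda\}$. Suppose that $\Phi$ is a regular generating function, that is: * $d_x\Phi\neq0$ on $Z$; * the projection $\pi:Z\to\Sigma$ has rank $n$, and the map $P:N^*(Z)\setminus0\to T^*(X)$, $P(x,\sigma;\nu_x,\nu_\sigma)=(x,\nu_x)$, is a local diffeomorphism, where $N^*(Z)\setminus 0$ is the set of nonzero conormal vectors of $Z$; * there are no $x\ne y$ in $X$ and $\sigma\in\Sigma$ with $\Phi(x,\sigma)=\Phi(y,\sigma)$ and $d_\sigma\Phi(x,\sigma)=d_\sigma\Phi(y,\sigma)$. For a function $f$ on $X$ (real or complex valued) let $$M_\Phi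 f(\lambda,\omega)=\int_{Z(\lambda,\omega)}\frac{f\,d_gS}{|\nabla_g\Phi|},$$ where $d_gS$ is the Riemannian $(n-1)$-dimensional surface element. Suppose that for each $x\in X$ the function $\theta(x,\cdot)$ is the restriction to $S^{n-1}$ of a polynomial on $\mathbb R^n$ of degree $\le m$. Let $f$ be integrable on $X$ with respect to $dV$ and vanish almost everywhere outside a compact set, and let $p(\lambda)$ be a polynomial of degree $\le k$. Then for every $\omega\in S^{n-1}$ the integral defining $M_\Phi f(\lambda,\omega)$ converges absolutely for almost every $\lambda\in\mathbb R$, the function $\lambda\mapsto p(\lambda)M_\Phi f(\lambda,\omega)$ is integrable on $\mathbb R$, and the function $$\omega\mapsto\int_{\mathbb R}p(\lambda)\,M_\Phi f(\lambda,\omega)\,d\lambda$$ is the restriction to $S^{n-1}$ of a polynomial on $\mathbb R^n$ of degree $\le mk$. -/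

import Mathlib

open MeasureTheory Set
open scoped Manifold ContDiff

noncomputable section

namespace MinkowskiFunk

/-- The unit sphere `S^d` in `(d+1)`-dimensional Euclidean space. -/
abbrev Sph (d : ℕ) : Type := Metric.sphere (0 : EuclideanSpace ℝ (Fin (d + 1))) 1

/-- A smooth Riemannian metric on the `n`-dimensional manifold `X`. -/
abbrev RMetric (n : ℕ) (X : Type*) [TopologicalSpace X] [ChartedSpace (EuclideanSpace ℝ (Fin n)) X]
    [IsManifold (𝓡 n) ∞ X] : Type _ :=
  Bundle.ContMDiffRiemannianMetric (𝓡 n) ∞ (EuclideanSpace ℝ (Fin n))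
    (fun x : X => TangentSpace (𝓡 n) x)

section Riemannian

variable {n : ℕ} {X : Type*} [TopologicalSpace X] [ChartedSpace (EuclideanSpace ℝ (Fin n)) X]
  [IsManifold (𝓡 n) ∞ X]

/-- The Riemannian metric at `x` as a bilinear form on the tangent space. -/
def metricForm (g : RMetric n X) (x : X) : LinearMap.BilinForm ℝ (TangentSpace (𝓡 n) x) :=
  LinearMap.mk₂ ℝ (fun v w => g.inner x v w) (by simp) (by simp) (by simp) (by simp)

theorem metricForm_nondegenerate (g : RMetric n X) (x : X) : (metricForm g x).Nondegenerate := by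
  refine ⟨fun v hv => ?_, fun v hv => ?_⟩ <;>
  · by_contra h
    exact (g.pos x v h).ne' (hv v)

/-- Tangent spaces have finite dimension. -/
instance (x : X) : FiniteDimensional ℝ (TangentSpace (𝓡 n) x) :=
  inferInstanceAs (FiniteDimensional ℝ (EuclideanSpace ℝ (Fin n)))

/-- The Riemannian gradient of `u` at `x`: the vector `∇u` with `g(∇u, v) = du(v)` for all `v`. -/
def gradient (g : RMetric n X) (u : X → ℝ) (x : X) : TangentSpace (𝓡 n) x :=
  ((metricForm g x).toDual (metricForm_nondegenerate g x)).symm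
    (mfderiv (𝓡 n) 𝓘(ℝ, ℝ) u x).toLinearMap

/-- The Riemannian length `|∇u|` of the gradient. -/
def gradientNorm (g : RMetric n X) (u : X → ℝ) (x : X) : ℝ :=
  √(g.inner x (gradient g u x) (gradient g u x))

/-- `ψ`, restricted to the open set `V ⊆ ℝᵏ`, is a regular `k`-dimensional parametrization of a
piece of `Z`: a smooth injective immersion with values in `Z`. -/
structure IsParametrization {k : ℕ} (Z : Set X) (V : Set (EuclideanSpace ℝ (Fin k)))
    (ψ : EuclideanSpace ℝ (Fin k) → X) : Prop where
  isOpen : IsOpen V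
  smooth : ContMDiffOn (𝓡 k) (𝓡 n) ∞ ψ V
  injOn : InjOn ψ V
  mapsTo : MapsTo ψ V Z
  immersion : ∀ y ∈ V, Function.Injective (mfderiv (𝓡 k) (𝓡 n) ψ y)

/-- The Riemannian volume density `√det (g(∂ᵢψ, ∂ⱼψ))` of `ψ` at `y`. -/
def gramDensity (g : RMetric n X) {k : ℕ} (ψ : EuclideanSpace ℝ (Fin k) → X)
    (y : EuclideanSpace ℝ (Fin k)) : ℝ :=
  √(Matrix.det (Matrix.of fun i j : Fin k =>
    g.inner (ψ y) (mfderiv (𝓡 k) (𝓡 n) ψ y (EuclideanSpace.single i (1 : ℝ)))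
      (mfderiv (𝓡 k) (𝓡 n) ψ y (EuclideanSpace.single j (1 : ℝ)))))

/-- The `k`-dimensional Riemannian measure on a `k`-dimensional submanifold `Z` of `X`. A regular
parametrization `ψ : V → Z` gives the measure `√det (g(∂ᵢψ, ∂ⱼψ)) dy` on `ψ(V)`; these measures
agree on overlaps, and gluing them is the same as taking their least upper bound. -/
def riemannianMeasure [MeasurableSpace X] (g : RMetric n X) (k : ℕ) (Z : Set X) : Measure X :=
  sSup {μ : Measure X | ∃ (V : Set (EuclideanSpace ℝ (Fin k))) (ψ : EuclideanSpace ℝ (Fin k) → X),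
    IsParametrization (n := n) Z V ψ ∧
      μ = Measure.map ψ
        ((volume.restrict V).withDensity fun y => ENNReal.ofReal (gramDensity g ψ y))}

/-- The Riemannian volume `dV` of `X`. -/
def riemannianVolume [MeasurableSpace X] (g : RMetric n X) : Measure X :=
  riemannianMeasure g n univ

end Riemannian

section Transform

variable {d : ℕ} {X : Type*} [TopologicalSpace X]
  [ChartedSpace (EuclideanSpace ℝ (Fin (d + 1))) X] [IsManifold (𝓡 (d + 1)) ∞ X]

/-- The resolved function `Φ(x; λ, ω) = θ(x, ω) - λ` on `X × Σ`, `Σ = ℝ × S^d`. -/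
def resolved (θ : X → Sph d → ℝ) (x : X) (σ : ℝ × Sph d) : ℝ := θ x σ.2 - σ.1

/-- The hypersurface `Z(σ) = {x : Φ(x, σ) = 0}`. -/
def hypersurface (θ : X → Sph d → ℝ) (σ : ℝ × Sph d) : Set X := {x | resolved θ x σ = 0}

/-- The cotangent bundle of `X`. -/
abbrev Cotangent (d : ℕ) (X : Type*) [TopologicalSpace X]
    [ChartedSpace (EuclideanSpace ℝ (Fin (d + 1))) X] [IsManifold (𝓡 (d + 1)) ∞ X] : Type _ :=
  Bundle.TotalSpace (EuclideanSpace ℝ (Fin (d + 1)) →L[ℝ] ℝ)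
    (fun x : X => TangentSpace (𝓡 (d + 1)) x →L[ℝ] Bundle.Trivial X ℝ x)

/-- The projection `P (x, σ; ν_x, ν_σ) = (x, ν_x)` from the conormal bundle of `Z = {Φ = 0}` to the
cotangent bundle of `X`. Here `Z` is parametrized by `(x, ω) ↦ (x; θ(x, ω), ω)`, a diffeomorphism
of `X × S^d` onto `Z`, and the conormals at a point of `Z` are the multiples `s dΦ`, so that
`ν_x = s d_x Φ`. -/
def conormalProj (θ : X → Sph d → ℝ) (q : (X × Sph d) × ℝ) : Cotangent d X :=
  ⟨q.1.1, q.2 • mfderiv (𝓡 (d + 1)) 𝓘(ℝ, ℝ)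
    (fun x => resolved θ x (θ q.1.1 q.1.2, q.1.2)) q.1.1⟩

/-- `Φ = θ - λ` is a regular (resolved) generating function. -/
structure IsRegularResolved (θ : X → Sph d → ℝ) : Prop where
  /-- `θ` is smooth on `X × S^d`. -/
  smooth : ContMDiff ((𝓡 (d + 1)).prod (𝓡 d)) 𝓘(ℝ, ℝ) ∞ (fun q : X × Sph d => θ q.1 q.2)
  /-- `d_x Φ ≠ 0` on `Z`. -/
  dx_ne_zero : ∀ (x : X) (σ : ℝ × Sph d), resolved θ x σ = 0 →
    mfderiv (𝓡 (d + 1)) 𝓘(ℝ, ℝ) (fun x' => resolved θ x' σ) x ≠ 0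
  /-- The projection `π : Z → Σ` has rank `dim Σ`; in the parametrization of `Z` by `X × S^d` it
  is `(x, ω) ↦ (θ(x, ω), ω)`. -/
  rank : ∀ q : X × Sph d, Function.Surjective
    (mfderiv ((𝓡 (d + 1)).prod (𝓡 d)) (𝓘(ℝ, ℝ).prod (𝓡 d))
      (fun q' : X × Sph d => ((θ q'.1 q'.2, q'.2) : ℝ × Sph d)) q)
  /-- `P` is a local diffeomorphism on the nonzero conormals. -/
  localDiffeo : IsLocalDiffeomorphOn (((𝓡 (d + 1)).prod (𝓡 d)).prod 𝓘(ℝ, ℝ))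
    ((𝓡 (d + 1)).prod 𝓘(ℝ, EuclideanSpace ℝ (Fin (d + 1)) →L[ℝ] ℝ)) ∞
    (conormalProj θ) {q | q.2 ≠ 0}
  /-- There are no conjugate points. -/
  no_conjugate : ∀ (x y : X) (σ : ℝ × Sph d), resolved θ x σ = resolved θ y σ →
    (mfderiv (𝓘(ℝ, ℝ).prod (𝓡 d)) 𝓘(ℝ, ℝ) (resolved θ x) σ :
        TangentSpace (𝓘(ℝ, ℝ).prod (𝓡 d)) σ →L[ℝ] ℝ) =
      mfderiv (𝓘(ℝ, ℝ).prod (𝓡 d)) 𝓘(ℝ, ℝ) (resolved θ y) σ → x = y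

/-- The integrand `f / |∇Φ(·, σ)|` of the transform. -/
def transformIntegrand {𝕜 : Type*} [RCLike 𝕜] (g : RMetric (d + 1) X) (θ : X → Sph d → ℝ)
    (f : X → 𝕜) (σ : ℝ × Sph d) (x : X) : 𝕜 :=
  f x / ((gradientNorm g (fun x' => resolved θ x' σ) x : ℝ) : 𝕜)

/-- The Riemannian hypersurface measure `dS` on `Z(σ)`. -/
def surfaceMeasure [MeasurableSpace X] (g : RMetric (d + 1) X) (θ : X → Sph d → ℝ)
    (σ : ℝ × Sph d) : Measure X :=
  riemannianMeasure g d (hypersurface θ σ)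

/-- The Minkowski-Funk transform `M_Φ f(σ) = ∫_{Z(σ)} f dS / |∇Φ|`. -/
def transform {𝕜 : Type*} [RCLike 𝕜] [MeasurableSpace X] (g : RMetric (d + 1) X)
    (θ : X → Sph d → ℝ) (f : X → 𝕜) (σ : ℝ × Sph d) : 𝕜 :=
  ∫ x, transformIntegrand g θ f σ x ∂(surfaceMeasure g θ σ)

/-- `F` is the restriction to the sphere of a polynomial of degree at most `N`. -/
def IsSpherePolynomial {𝕜 : Type*} [RCLike 𝕜] (N : ℕ) (F : Sph d → 𝕜) : Prop :=
  ∃ Q : MvPolynomial (Fin (d + 1)) 𝕜, Q.totalDegree ≤ N ∧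
    ∀ w : Sph d, F w = MvPolynomial.eval (fun i => ((w.1 i : ℝ) : 𝕜)) Q

end Transform

end MinkowskiFunk

end

/-! Fix ω and put u = θ(·, ω). Since d_xΦ ≠ 0, u has no critical points, and the coarea formula says
that the measures dS/|∇u| on the level sets {u = λ} disintegrate the Riemannian volume over dλ. A
function p(λ) is equal to p(u) on the level set, so it may be moved under the inner integral, and

∫ p(λ) M_Φ f(λ, ω) dλ = ∫ p(θ(x, ω)) f(x) dV(x).

The right side converges because f is integrable and p ∘ u is bounded on the compact set carrying f
(`integrable_continuous_mul`). For each x the function p(θ(x, ·)) is a polynomial of degree at most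
mk on the sphere. Such functions form a finite-dimensional space, and integration in x does not
leave it (`isSpherePolynomial_integral`).

The coarea formula is local. Near each point there is a chart with first coordinate u
(`exists_isAdaptedChart`). If G is the Gram matrix of its coordinate fields, Cramer's rule gives det
G · |∇u|² = the minor of G without row and column 0 (`IsAdaptedChart.det_gramMatrix_mul`). That
minor is the Gram determinant of the slice u = λ, so dividing the surface density by |∇u| leaves the
volume density, and Tonelli's theorem finishes. As Riemannian measures are defined as suprema over
all parametrizations, `riemannianMeasure_restrict` is needed to compute them with a single one;
countably many charts then cover X (`coarea_apply`). -/

noncomputable section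

namespace MinkowskiFunk

/-! ### Interpolation in finite-dimensional function spaces -/

section Interpolation

/-- Functions in a finite-dimensional space are determined linearly by finitely many values. -/
theorem exists_interpolation {S K : Type*} [Field K] (E : Submodule K (S → K))
    [FiniteDimensional K E] :
    ∃ (r : ℕ) (s : Fin r → S) (c : Fin r → S → K), (∀ j, c j ∈ E) ∧
      ∀ F ∈ E, ∀ w, F w = ∑ j, F (s j) * c j w := by
  let ev : S → Module.Dual K E := fun w => (LinearMap.proj w).comp E.subtype
  -- A function in E on which all point evaluations vanish is zero, so the evaluations span the dual
  -- of E.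
  have hspan : Submodule.span K (range ev) = ⊤ := by
    apply Submodule.span_eq_top_of_ne_zero
    intro F hF
    by_contra! h
    apply hF
    ext w
    simpa [ev] using h (ev w) ⟨w, rfl⟩
  obtain ⟨b, hb, hbs, hli⟩ := exists_linearIndependent K (range ev)
  rw [hspan] at hbs
  let B : Module.Basis b K (Module.Dual K E) := Module.Basis.mk hli (by simp [hbs])
  have : Finite b := Module.Finite.finite_basis B
  have : Fintype b := Fintype.ofFinite b
  choose t ht using fun i : b => hb i.2
  let φ : Fin (Fintype.card b) ≃ b := (Fintype.equivFin b).symm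
  refine ⟨Fintype.card b, fun j => t (φ j),
    fun j w => B.repr (ev w) (φ j), fun j => ?_, fun F hF w => ?_⟩
  -- By reflexivity the coordinate functional on the dual is evaluation at some F in E, and this F
  -- is the function `c j`.
  · obtain ⟨F, hF⟩ := (Module.evalEquiv K E).surjective (B.coord (φ j))
    convert F.2 using 1
    ext w
    have := LinearMap.congr_fun hF (ev w)
    simpa [ev] using this.symm
  · have h := congrArg (fun l => l ⟨F, hF⟩) (B.sum_repr (ev w))
    simp only [LinearMap.coe_sum, Finset.sum_apply, LinearMap.smul_apply, smul_eq_mul] at h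
    change _ = F w at h
    rw [← h, ← Equiv.sum_comp φ]
    refine Finset.sum_congr rfl fun j _ => ?_
    rw [mul_comm]
    congr 1
    have : B (φ j) = ev (t (φ j)) := by simp [B, ht]
    rw [this]; rfl

end Interpolation

/-! ### Polynomials on the sphere -/

section SpherePolynomial

variable {d : ℕ} {𝕜 : Type*} [RCLike 𝕜]

/-- The space of restrictions to the sphere of polynomials of degree at most `N`. -/
def spherePolynomials (𝕜 : Type*) [RCLike 𝕜] (d N : ℕ) : Submodule 𝕜 (Sph d → 𝕜) :=
  (MvPolynomial.restrictTotalDegree (Fin (d + 1)) 𝕜 N).map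
    (LinearMap.pi fun w : Sph d =>
      (MvPolynomial.aeval (R := 𝕜) fun i => ((w.1 i : ℝ) : 𝕜)).toLinearMap)

theorem mem_spherePolynomials {N : ℕ} {F : Sph d → 𝕜} :
    F ∈ spherePolynomials 𝕜 d N ↔ IsSpherePolynomial N F := by
  simp only [spherePolynomials, Submodule.mem_map, MvPolynomial.mem_restrictTotalDegree,
    IsSpherePolynomial, funext_iff]
  refine exists_congr fun Q => and_congr_right fun _ => forall_congr' fun w => ?_
  rw [eq_comm]
  simp [MvPolynomial.aeval_eq_eval]

instance (N : ℕ) : FiniteDimensional 𝕜 (spherePolynomials 𝕜 d N) := by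
  unfold spherePolynomials
  infer_instance

/-- Composing a polynomial with a real polynomial function on the sphere. -/
theorem IsSpherePolynomial.polynomial_eval {m k : ℕ} {u : Sph d → ℝ}
    (hu : IsSpherePolynomial m u) {p : Polynomial 𝕜} (hp : p.natDegree ≤ k) :
    IsSpherePolynomial (m * k) fun w => p.eval ((u w : ℝ) : 𝕜) := by
  obtain ⟨Q, hQ, hQu⟩ := hu
  let Q' : MvPolynomial (Fin (d + 1)) 𝕜 := MvPolynomial.map (algebraMap ℝ 𝕜) Q
  have hQ' : Q'.totalDegree ≤ m := 
    (Finset.sup_mono (MvPolynomial.support_map_subset _ _)).trans hQ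
  refine ⟨p.sum fun i a => MvPolynomial.C a * Q' ^ i, ?_, fun w => ?_⟩
  · refine (MvPolynomial.totalDegree_finsetSum _ _).trans (Finset.sup_le fun i hi => ?_)
    refine (MvPolynomial.totalDegree_mul _ _).trans ?_
    rw [MvPolynomial.totalDegree_C, zero_add]
    refine (MvPolynomial.totalDegree_pow _ _).trans ?_
    rw [mul_comm]
    exact Nat.mul_le_mul hQ' ((Polynomial.le_natDegree_of_mem_supp i hi).trans hp)
  · have h : MvPolynomial.eval (fun i => ((w.1 i : ℝ) : 𝕜)) Q' = ((u w : ℝ) : 𝕜) := by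
      rw [hQu w, MvPolynomial.eval_map]
      exact (MvPolynomial.eval₂_comp_left (algebraMap ℝ 𝕜) (RingHom.id ℝ) _ Q).symm
    beta_reduce
    rw [Polynomial.sum_def, map_sum, Polynomial.eval_eq_sum, Polynomial.sum_def]
    simp [h]

/-- Integrals of families of polynomials on the sphere are polynomials on the sphere. -/
theorem isSpherePolynomial_integral {X : Type*} [MeasurableSpace X] {μ : Measure X} {N : ℕ}
    {F : X → Sph d → 𝕜} (hF : ∀ x, IsSpherePolynomial N (F x))
    (hint : ∀ w, Integrable (fun x => F x w) μ) :
    IsSpherePolynomial N fun w => ∫ x, F x w ∂μ := by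
  -- Coefficients of F x could depend on x without any measurability. Interpolation replaces them by
  -- the values F x (s j), which are integrable in x.
  obtain ⟨r, s, c, hc, h⟩ := exists_interpolation (spherePolynomials 𝕜 d N)
  rw [← mem_spherePolynomials]
  have : (fun w => ∫ x, F x w ∂μ) = ∑ j, (∫ x, F x (s j) ∂μ) • c j := by
    ext w
    simp_rw [h _ (mem_spherePolynomials.2 (hF _)) w]
    rw [integral_finsetSum _ fun j _ => (hint (s j)).mul_const _]
    simp [integral_mul_const]
  rw [this]
  exact Submodule.sum_mem _ fun j _ => Submodule.smul_mem _ _ (hc j)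

end SpherePolynomial

/-! ### Suprema of measures and measurability -/

section Measure

/-- On a measurable set where one member of a family of measures dominates all the others, the
supremum of the family is this member. -/
theorem restrict_sSup_eq {α : Type*} [MeasurableSpace α] {S : Set (Measure α)} {μ₀ : Measure α}
    (h₀ : μ₀ ∈ S) {A : Set α} (hA : MeasurableSet A)
    (h : ∀ μ ∈ S, μ.restrict A ≤ μ₀.restrict A) : (sSup S).restrict A = μ₀.restrict A := by
  refine le_antisymm ?_ (Measure.restrict_mono le_rfl (le_sSup h₀))
  -- Each member is bounded off A by the supremum and on A by μ₀. Restricting the resulting bound to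
  -- A removes the first term.
  have hle : sSup S ≤ (sSup S).restrict Aᶜ + μ₀.restrict A := by
    refine sSup_le fun μ hμ => ?_
    rw [← Measure.restrict_compl_add_restrict hA (μ := μ)]
    exact add_le_add (Measure.restrict_mono le_rfl (le_sSup hμ)) (h μ hμ)
  refine (Measure.restrict_mono le_rfl hle).trans ?_
  rw [Measure.restrict_add, Measure.restrict_restrict hA, Measure.restrict_restrict hA]
  simp

/-- The part over a measurable set of a map which is continuous on a measurable set is
measurable. -/
theorem measurableSet_inter_preimage {α β : Type*} [TopologicalSpace α] [MeasurableSpace α]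
    [OpensMeasurableSpace α] [TopologicalSpace β] [MeasurableSpace β] [BorelSpace β]
    {ψ : α → β} {V : Set α} (hV : MeasurableSet V) (hψ : ContinuousOn ψ V) {A : Set β}
    (hA : MeasurableSet A) : MeasurableSet (V ∩ ψ ⁻¹' A) := by
  have h := hψ.domRestrict.measurable hA
  have := hV.subtype_image h
  rwa [domRestrict_eq, preimage_comp, Subtype.image_preimage_coe] at this

end Measure

/-! ### Gram densities and Riemannian measures -/

section Gram

variable {n : ℕ} {X : Type*} [TopologicalSpace X] [ChartedSpace (EuclideanSpace ℝ (Fin n)) X]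
  [IsManifold (𝓡 n) ∞ X] {k : ℕ}

/-- The metric at a point as a bilinear form on the model space. -/
def modelForm (g : RMetric n X) (x : X) :
    EuclideanSpace ℝ (Fin n) →L[ℝ] EuclideanSpace ℝ (Fin n) →L[ℝ] ℝ := g.inner x

/-- The derivative of a map into `X` as a linear map of the model spaces. -/
def modelDeriv (ψ : EuclideanSpace ℝ (Fin k) → X) (y : EuclideanSpace ℝ (Fin k)) :
    EuclideanSpace ℝ (Fin k) →L[ℝ] EuclideanSpace ℝ (Fin n) := mfderiv (𝓡 k) (𝓡 n) ψ y

/-- The Gram matrix of the partial derivatives of `ψ`. -/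
def gramMatrix (g : RMetric n X) (ψ : EuclideanSpace ℝ (Fin k) → X)
    (y : EuclideanSpace ℝ (Fin k)) : Matrix (Fin k) (Fin k) ℝ :=
  Matrix.of fun i j => modelForm g (ψ y) (modelDeriv (n := n) ψ y (EuclideanSpace.single i 1))
    (modelDeriv (n := n) ψ y (EuclideanSpace.single j 1))

theorem gramDensity_eq (g : RMetric n X) (ψ : EuclideanSpace ℝ (Fin k) → X)
    (y : EuclideanSpace ℝ (Fin k)) : gramDensity g ψ y = √(gramMatrix g ψ y).det := rfl

theorem gramMatrix_congr (g : RMetric n X) {ψ φ : EuclideanSpace ℝ (Fin k) → X}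
    {y : EuclideanSpace ℝ (Fin k)} (h : ψ =ᶠ[nhds y] φ) : gramMatrix g ψ y = gramMatrix g φ y := by
  have h1 : modelDeriv (n := n) ψ y = modelDeriv φ y := h.mfderiv_eq
  unfold gramMatrix
  rw [h1, h.eq_of_nhds]

theorem euclideanSpace_eq_sum_single (v : EuclideanSpace ℝ (Fin k)) :
    v = ∑ i, v i • EuclideanSpace.single i (1 : ℝ) := by
  simpa using ((EuclideanSpace.basisFun (Fin k) ℝ).sum_repr v).symm

/-- A bilinear form evaluated on linear combinations of two families. -/
theorem form_comp_apply {E : Type*} [NormedAddCommGroup E] [NormedSpace ℝ E] {l : ℕ}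
    (B : E →L[ℝ] E →L[ℝ] ℝ) (L : EuclideanSpace ℝ (Fin k) →L[ℝ] E)
    (M : EuclideanSpace ℝ (Fin l) →L[ℝ] E) (v : EuclideanSpace ℝ (Fin k))
    (w : EuclideanSpace ℝ (Fin l)) :
    B (L v) (M w) = ∑ a, ∑ b, v a * w b *
      B (L (EuclideanSpace.single a 1)) (M (EuclideanSpace.single b 1)) := by
  conv_lhs => rw [euclideanSpace_eq_sum_single v, euclideanSpace_eq_sum_single w]
  simp only [map_sum, map_smul, sum_apply, smul_apply,
    smul_eq_mul, Finset.mul_sum]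
  rw [Finset.sum_comm]
  refine Finset.sum_congr rfl fun a _ => Finset.sum_congr rfl fun b _ => by ring

/-- By the chain rule the Gram matrix G turns into TᵀGT, whose determinant carries the factor (det
T)². -/
theorem gramDensity_comp (g : RMetric n X) {ψ : EuclideanSpace ℝ (Fin k) → X}
    {τ : EuclideanSpace ℝ (Fin k) → EuclideanSpace ℝ (Fin k)} {y : EuclideanSpace ℝ (Fin k)}
    {T : EuclideanSpace ℝ (Fin k) →L[ℝ] EuclideanSpace ℝ (Fin k)} (hτ : HasFDerivAt τ T y)
    (hψ : MDifferentiableAt (𝓡 k) (𝓡 n) ψ (τ y)) :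
    gramDensity g (ψ ∘ τ) y = |T.det| * gramDensity g ψ (τ y) := by
  have h1 : modelDeriv (n := n) (ψ ∘ τ) y = (modelDeriv ψ (τ y)).comp T :=
    (hψ.hasMFDerivAt.comp y hτ.hasMFDerivAt).mfderiv
  let b := (EuclideanSpace.basisFun (Fin k) ℝ).toBasis
  let M := LinearMap.toMatrix b b T.toLinearMap
  have h2 : gramMatrix g (ψ ∘ τ) y = M.transpose * gramMatrix g ψ (τ y) * M := by
    ext i j
    simp only [gramMatrix, h1, Matrix.of_apply, ContinuousLinearMap.comp_apply, Function.comp]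
    rw [form_comp_apply]
    simp only [Matrix.mul_apply, Matrix.transpose_apply, Finset.sum_mul, Matrix.of_apply]
    rw [Finset.sum_comm]
    refine Finset.sum_congr rfl fun a _ => Finset.sum_congr rfl fun c _ => ?_
    simp only [M, LinearMap.toMatrix_apply, b]
    simp
    ring
  have h3 : M.det = T.det := LinearMap.det_toMatrix b T.toLinearMap
  rw [gramDensity_eq, gramDensity_eq, h2, Matrix.det_mul, Matrix.det_mul, Matrix.det_transpose,
    h3, show T.det * (gramMatrix g ψ (τ y)).det * T.det
      = T.det ^ 2 * (gramMatrix g ψ (τ y)).det by ring,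
    Real.sqrt_mul (sq_nonneg _), Real.sqrt_sq_eq_abs]

/-- The Gram matrix of a smooth map is continuous. -/
theorem continuousOn_gramMatrix (g : RMetric n X) {V : Set (EuclideanSpace ℝ (Fin k))}
    (hV : IsOpen V) {ψ : EuclideanSpace ℝ (Fin k) → X} (hψ : ContMDiffOn (𝓡 k) (𝓡 n) ∞ ψ V) :
    ContinuousOn (gramMatrix g ψ) V := by
  -- The field dψ(v) along ψ is the tangent map of ψ applied to a constant field, hence continuous
  -- as a map into the tangent bundle.
  have hsec : ∀ v : EuclideanSpace ℝ (Fin k), ContMDiffOn (𝓡 k) ((𝓡 n).prod (𝓡 n)) 0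
      (fun y => Bundle.TotalSpace.mk' (EuclideanSpace ℝ (Fin n))
        (E := fun x : X => TangentSpace (𝓡 n) x) (ψ y) (mfderiv (𝓡 k) (𝓡 n) ψ y v)) V := by
    intro v
    have h1 := hψ.contMDiffOn_tangentMapWithin (m := 0) (by norm_num) hV.uniqueMDiffOn
    have h2 : ContMDiffOn (𝓡 k) ((𝓡 k).prod (𝓡 k)) 0
        (fun y => (⟨y, v⟩ : TangentBundle (𝓡 k) (EuclideanSpace ℝ (Fin k)))) V := by
      intro y _
      exact (contMDiffWithinAt_vectorSpace_iff_contDiffWithinAt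
        (V := fun _ : EuclideanSpace ℝ (Fin k) => v)).2 contDiffWithinAt_const
    refine (h1.comp h2 fun y hy => hy).congr fun y hy => ?_
    simp [tangentMapWithin, mfderivWithin_of_isOpen hV hy]
  refine continuousOn_pi.2 fun i => continuousOn_pi.2 fun j => ?_
  have hm : ContMDiffOn (𝓡 k) ((𝓡 n).prod 𝓘(ℝ, EuclideanSpace ℝ (Fin n) →L[ℝ]
      EuclideanSpace ℝ (Fin n) →L[ℝ] ℝ)) 0 (fun y => Bundle.TotalSpace.mk'
        (EuclideanSpace ℝ (Fin n) →L[ℝ] EuclideanSpace ℝ (Fin n) →L[ℝ] ℝ)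
        (E := fun x : X => (TangentSpace (𝓡 n) x →L[ℝ] TangentSpace (𝓡 n) x →L[ℝ]
          Bundle.Trivial X ℝ x)) (ψ y) (g.inner (ψ y))) V :=
    (g.contMDiff.of_le (by simp)).comp_contMDiffOn (hψ.of_le (by simp))
  have := ContMDiffOn.clm_bundle_apply₂ (F₁ := EuclideanSpace ℝ (Fin n))
    (F₂ := EuclideanSpace ℝ (Fin n)) (F₃ := ℝ) (E₃ := Bundle.Trivial X ℝ) hm
    (hsec (EuclideanSpace.single i 1)) (hsec (EuclideanSpace.single j 1))
  have h := fun y hy => ((Bundle.contMDiffWithinAt_totalSpace).1 (this y hy)).2.continuousWithinAt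
  exact h

theorem continuousOn_gramDensity (g : RMetric n X) {V : Set (EuclideanSpace ℝ (Fin k))}
    (hV : IsOpen V) {ψ : EuclideanSpace ℝ (Fin k) → X} (hψ : ContMDiffOn (𝓡 k) (𝓡 n) ∞ ψ V) :
    ContinuousOn (gramDensity g ψ) V :=
  (Continuous.comp_continuousOn (by fun_prop : Continuous fun M : Matrix (Fin k) (Fin k) ℝ =>
    √M.det) (continuousOn_gramMatrix g hV hψ) :)

/-- The measure that a parametrization `ψ` on `V` gives to a measurable set. -/
theorem map_gramDensity_apply [MeasurableSpace X] [BorelSpace X] (g : RMetric n X)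
    {V : Set (EuclideanSpace ℝ (Fin k))} (hV : IsOpen V) {ψ : EuclideanSpace ℝ (Fin k) → X}
    (hψ : ContinuousOn ψ V) {A : Set X} (hA : MeasurableSet A) :
    Measure.map ψ ((volume.restrict V).withDensity fun y => ENNReal.ofReal (gramDensity g ψ y)) A
      = ∫⁻ y in V ∩ ψ ⁻¹' A, ENNReal.ofReal (gramDensity g ψ y) := by
  have hm : AEMeasurable ψ (volume.restrict V) := hψ.aemeasurable hV.measurableSet
  have hm' := hm.mono_ac (withDensity_absolutelyContinuous (volume.restrict V)
    fun y => ENNReal.ofReal (gramDensity g ψ y))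
  rw [Measure.map_apply_of_aemeasurable hm' hA, withDensity_apply', Measure.restrict_restrict' hV.measurableSet,
    inter_comm]

/-- A parametrization of a relatively open piece `Z ∩ O` of `Z` with an inverse that extends
smoothly to `O` computes the Riemannian measure of `Z` on `O`. -/
theorem riemannianMeasure_restrict [MeasurableSpace X] [BorelSpace X] (g : RMetric n X)
    {Z O : Set X} (hO : IsOpen O) {V : Set (EuclideanSpace ℝ (Fin k))}
    {ψ : EuclideanSpace ℝ (Fin k) → X} (hψ : IsParametrization (n := n) Z V ψ)
    {ρ : X → EuclideanSpace ℝ (Fin k)} (hρ : ContMDiffOn (𝓡 n) (𝓡 k) ∞ ρ O)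
    (hρV : ∀ x ∈ Z ∩ O, ρ x ∈ V) (hψρ : ∀ x ∈ Z ∩ O, ψ (ρ x) = x) :
    (riemannianMeasure g k Z).restrict O = (Measure.map ψ
      ((volume.restrict V).withDensity fun y => ENNReal.ofReal (gramDensity g ψ y))).restrict O := by
  unfold riemannianMeasure
  refine restrict_sSup_eq (mem_ofPred.2 ⟨V, ψ, hψ, rfl⟩) hO.measurableSet fun μ hμ => ?_
  obtain ⟨W, φ, hφ, rfl⟩ := mem_ofPred.1 hμ
  refine Measure.le_iff.2 fun A hA => ?_
  rw [Measure.restrict_apply hA, Measure.restrict_apply hA,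
    map_gramDensity_apply g hφ.isOpen hφ.smooth.continuousOn (hA.inter hO.measurableSet),
    map_gramDensity_apply g hψ.isOpen hψ.smooth.continuousOn (hA.inter hO.measurableSet)]
  set s := W ∩ φ ⁻¹' (A ∩ O) with hs
  have hsm : MeasurableSet s := measurableSet_inter_preimage hφ.isOpen.measurableSet
    hφ.smooth.continuousOn (hA.inter hO.measurableSet)
  have hU : IsOpen (W ∩ φ ⁻¹' O) := hφ.smooth.continuousOn.isOpen_inter_preimage hφ.isOpen hO
  -- The transition map ρ ∘ φ is smooth and φ = ψ ∘ (ρ ∘ φ) over O, so the two densities are related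
  -- by its Jacobian.
  have hτ : ∀ y ∈ W ∩ φ ⁻¹' O, HasFDerivAt (ρ ∘ φ) (fderiv ℝ (ρ ∘ φ) y) y := by
    intro y hy
    have h1 : ContMDiffAt (𝓡 k) (𝓡 k) ∞ (ρ ∘ φ) y :=
      (hρ.contMDiffAt (hO.mem_nhds hy.2)).comp y
        (hφ.smooth.contMDiffAt (hφ.isOpen.mem_nhds hy.1))
    exact (h1.contDiffAt.differentiableAt (by simp)).hasFDerivAt
  have hcomp : ∀ y ∈ W ∩ φ ⁻¹' O, ψ (ρ (φ y)) = φ y := fun y hy =>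
    hψρ _ ⟨hφ.mapsTo hy.1, hy.2⟩
  have hsub : ∀ y ∈ s, y ∈ W ∩ φ ⁻¹' O := fun y hy => ⟨hy.1, hy.2.2⟩
  have hinj : InjOn (ρ ∘ φ) s := by
    intro y hy z hz hyz
    refine hφ.injOn hy.1 hz.1 ?_
    rw [← hcomp y (hsub y hy), ← hcomp z (hsub z hz)]
    exact congrArg ψ hyz
  have hgram : ∀ y ∈ s, ENNReal.ofReal (gramDensity g φ y) =
      ENNReal.ofReal |(fderiv ℝ (ρ ∘ φ) y).det| *
        ENNReal.ofReal (gramDensity g ψ ((ρ ∘ φ) y)) := by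
    intro y hy
    have hy' := hsub y hy
    have hev : φ =ᶠ[nhds y] ψ ∘ (ρ ∘ φ) := by
      filter_upwards [hU.mem_nhds hy'] with z hz using (hcomp z hz).symm
    have hρy : ρ (φ y) ∈ V := hρV _ ⟨hφ.mapsTo hy.1, hy'.2⟩
    rw [gramDensity_eq, gramMatrix_congr g hev, ← gramDensity_eq,
      gramDensity_comp g (hτ y hy') ((hψ.smooth.contMDiffAt
        (hψ.isOpen.mem_nhds hρy)).mdifferentiableAt (by simp)),
      ENNReal.ofReal_mul (abs_nonneg _)]
  rw [setLIntegral_congr_fun hsm hgram, ← lintegral_image_eq_lintegral_abs_det_fderiv_mul volume hsm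
    (fun y hy => (hτ y (hsub y hy)).hasFDerivWithinAt) hinj
    fun y => ENNReal.ofReal (gramDensity g ψ y)]
  -- An inclusion suffices: φ may cover only a part of what ψ covers.
  refine lintegral_mono_set ?_
  rintro _ ⟨y, hy, rfl⟩
  refine ⟨hρV _ ⟨hφ.mapsTo hy.1, hy.2.2⟩, ?_⟩
  change ψ (ρ (φ y)) ∈ A ∩ O
  rw [hcomp y (hsub y hy)]
  exact hy.2

end Gram

/-! ### Splitting off the first coordinate -/

section Coordinates

variable {d : ℕ}

/-- The inclusion `y ↦ (0, y)`. -/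
def inclZero (d : ℕ) : EuclideanSpace ℝ (Fin d) →L[ℝ] EuclideanSpace ℝ (Fin (d + 1)) :=
  LinearMap.toContinuousLinearMap
    { toFun := fun y => WithLp.toLp 2 (Fin.cons 0 y : Fin (d + 1) → ℝ)
      map_add' := fun y z => by ext i; refine Fin.cases ?_ (fun j => ?_) i <;> simp
      map_smul' := fun c y => by ext i; refine Fin.cases ?_ (fun j => ?_) i <;> simp }

/-- The projection `(l, y) ↦ y`. -/
def tailProj (d : ℕ) : EuclideanSpace ℝ (Fin (d + 1)) →L[ℝ] EuclideanSpace ℝ (Fin d) :=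
  LinearMap.toContinuousLinearMap
    { toFun := fun z => WithLp.toLp 2 fun i : Fin d => z i.succ
      map_add' := fun y z => by ext i; simp
      map_smul' := fun c y => by ext i; simp }

/-- The point `(l, y)`. -/
def consPoint (l : ℝ) (y : EuclideanSpace ℝ (Fin d)) : EuclideanSpace ℝ (Fin (d + 1)) :=
  EuclideanSpace.single 0 l + inclZero d y

@[simp] theorem inclZero_zero (y : EuclideanSpace ℝ (Fin d)) : inclZero d y 0 = 0 := rfl

@[simp] theorem inclZero_succ (y : EuclideanSpace ℝ (Fin d)) (i : Fin d) :
    inclZero d y i.succ = y i := rfl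

@[simp] theorem tailProj_apply (z : EuclideanSpace ℝ (Fin (d + 1))) (i : Fin d) :
    tailProj d z i = z i.succ := rfl

@[simp] theorem consPoint_zero (l : ℝ) (y : EuclideanSpace ℝ (Fin d)) : consPoint l y 0 = l := by
  simp [consPoint]

@[simp] theorem consPoint_succ (l : ℝ) (y : EuclideanSpace ℝ (Fin d)) (i : Fin d) :
    consPoint l y i.succ = y i := by
  simp [consPoint]

@[simp] theorem tailProj_consPoint (l : ℝ) (y : EuclideanSpace ℝ (Fin d)) :
    tailProj d (consPoint l y) = y := by
  ext i; simp

theorem consPoint_tailProj (z : EuclideanSpace ℝ (Fin (d + 1))) :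
    consPoint (z 0) (tailProj d z) = z := by
  ext i; refine Fin.cases ?_ (fun j => ?_) i <;> simp

theorem inclZero_single (i : Fin d) :
    inclZero d (EuclideanSpace.single i 1) = EuclideanSpace.single i.succ 1 := by
  ext j
  refine Fin.cases ?_ (fun j => ?_) j
  · simp
  · simp

theorem hasFDerivAt_consPoint (l : ℝ) (y : EuclideanSpace ℝ (Fin d)) :
    HasFDerivAt (consPoint l) (inclZero d) y :=
  (inclZero d).hasFDerivAt.const_add _

theorem contDiff_consPoint (l : ℝ) : ContDiff ℝ ∞ (consPoint (d := d) l) :=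
  contDiff_const.add (inclZero d).contDiff

theorem measurePreserving_consPoint :
    MeasurePreserving (fun q : ℝ × EuclideanSpace ℝ (Fin d) => consPoint q.1 q.2)
      (volume.prod volume) volume := by
  have h1 := (volume_preserving_piFinSuccAbove (fun _ : Fin (d + 1) => ℝ) 0).symm
  have h2 := (MeasurePreserving.id (volume : Measure ℝ)).prod (PiLp.volume_preserving_ofLp (Fin d))
  have h3 := (PiLp.volume_preserving_toLp (Fin (d + 1))).comp (h1.comp h2)
  have h : (fun q : ℝ × EuclideanSpace ℝ (Fin d) => consPoint q.1 q.2) = WithLp.toLp 2 ∘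
      (MeasurableEquiv.piFinSuccAbove (fun _ : Fin (d + 1) => ℝ) 0).symm ∘
        Prod.map id WithLp.ofLp := by
    ext q i
    refine Fin.cases ?_ (fun j => ?_) i
    · simp [MeasurableEquiv.piFinSuccAbove]
    · simp [MeasurableEquiv.piFinSuccAbove]
  rw [h]
  exact h3

/-- A nonzero linear functional is the first coordinate in some linear coordinate system. -/
theorem exists_equiv_apply_zero_eq {l : EuclideanSpace ℝ (Fin (d + 1)) →L[ℝ] ℝ} (hl : l ≠ 0) :
    ∃ A : EuclideanSpace ℝ (Fin (d + 1)) ≃L[ℝ] EuclideanSpace ℝ (Fin (d + 1)),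
      ∀ z, A z 0 = l z := by
  set v := (InnerProductSpace.toDual ℝ _).symm l with hv
  have hv0 : v ≠ 0 := by simpa [hv] using hl
  have he : (EuclideanSpace.single (0 : Fin (d + 1)) (1 : ℝ)) ≠ 0 := by simp
  obtain ⟨B, hB⟩ := SeparatingDual.exists_continuousLinearEquiv_apply_eq (R := ℝ) he hv0
  -- B sends e₀ to the vector v representing l, so ⟨e₀, B*z⟩ = ⟨v, z⟩ = l z.
  let A := ContinuousLinearMap.adjoint B.toContinuousLinearMap
  have hA : Function.Injective A := by
    rw [injective_iff_map_eq_zero]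
    intro z hz
    refine ext_inner_right ℝ fun w => ?_
    rw [← B.apply_symm_apply w, inner_zero_left]
    have := ContinuousLinearMap.adjoint_inner_left
      B.toContinuousLinearMap (B.symm w) z
    change inner ℝ (A z) _ = inner ℝ z (B _) at this
    rw [← this, hz, inner_zero_left]
  refine ⟨(LinearEquiv.ofInjectiveEndo A.toLinearMap hA).toContinuousLinearEquiv, fun z => ?_⟩
  have h1 : inner ℝ (EuclideanSpace.single (0 : Fin (d + 1)) (1 : ℝ)) (A z) = A z 0 := by
    simp [EuclideanSpace.inner_single_left]
  have h2 : inner ℝ v z = l z := by simp [hv]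
  change A z 0 = _
  rw [← h1, ← h2, ContinuousLinearMap.adjoint_inner_right]
  simp [hB]

end Coordinates

/-! ### Charts with a prescribed first coordinate -/

section AdaptedChart

variable {d : ℕ} {X : Type*} [TopologicalSpace X]
  [ChartedSpace (EuclideanSpace ℝ (Fin (d + 1))) X] [IsManifold (𝓡 (d + 1)) ∞ X]

/-- A chart whose first coordinate is the function `u`. -/
structure IsAdaptedChart (u : X → ℝ)
    (e : OpenPartialHomeomorph X (EuclideanSpace ℝ (Fin (d + 1)))) : Prop where
  smooth : ContMDiffOn (𝓡 (d + 1)) (𝓡 (d + 1)) ∞ e e.source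
  smooth_symm : ContMDiffOn (𝓡 (d + 1)) (𝓡 (d + 1)) ∞ e.symm e.target
  apply_zero : ∀ x ∈ e.source, e x 0 = u x

/-- The inverse function theorem for a map that is smooth on an open set. -/
theorem exists_openPartialHomeomorph_contDiffOn {E : Type*} [NormedAddCommGroup E]
    [NormedSpace ℝ E] [CompleteSpace E] {F : E → E} {U : Set E} (hU : IsOpen U)
    (hF : ContDiffOn ℝ ∞ F U) {a : E} (ha : a ∈ U) {A : E ≃L[ℝ] E}
    (hA : HasFDerivAt F (A : E →L[ℝ] E) a) :
    ∃ P : OpenPartialHomeomorph E E, a ∈ P.source ∧ P.source ⊆ U ∧ ⇑P = F ∧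
      ContDiffOn ℝ ∞ P.symm P.target := by
  let P := (hF.contDiffAt (hU.mem_nhds ha)).toOpenPartialHomeomorph F hA (by simp)
  -- The inverse is smooth at images of points with invertible derivative; these form an open set,
  -- to which the local inverse is restricted.
  let G := U ∩ fderiv ℝ F ⁻¹' range ((↑) : (E ≃L[ℝ] E) → E →L[ℝ] E)
  have hG : IsOpen G := (hF.continuousOn_fderiv_of_isOpen hU (by simp)).isOpen_inter_preimage hU
    ContinuousLinearEquiv.isOpen
  have hs : (P.restrOpen G hG).source = P.source ∩ G := P.restrOpen_source G hG
  refine ⟨P.restrOpen G hG, ?_, ?_, rfl, fun b hb => ?_⟩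
  · rw [hs]
    exact ⟨ContDiffAt.mem_toOpenPartialHomeomorph_source _ hA (by simp), ha, A, hA.fderiv.symm⟩
  · rw [hs]
    exact fun z hz => hz.2.1
  · have hz := (P.restrOpen G hG).map_target hb
    rw [hs] at hz
    obtain ⟨-, hzU, B, hB⟩ := hz
    have hc := hF.contDiffAt (hU.mem_nhds hzU)
    refine (OpenPartialHomeomorph.contDiffAt_symm (P.restrOpen G hG) (f₀' := B) hb ?_
      hc).contDiffWithinAt
    rw [hB]
    exact (hc.differentiableAt (by simp)).hasFDerivAt

/-- A function without critical points is the first coordinate of a chart near any point. -/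
theorem exists_isAdaptedChart {u : X → ℝ} (hu : ContMDiff (𝓡 (d + 1)) 𝓘(ℝ, ℝ) ∞ u) {x : X}
    (hx : mfderiv (𝓡 (d + 1)) 𝓘(ℝ, ℝ) u x ≠ 0) :
    ∃ e : OpenPartialHomeomorph X (EuclideanSpace ℝ (Fin (d + 1))),
      x ∈ e.source ∧ IsAdaptedChart u e := by
  let φ := chartAt (EuclideanSpace ℝ (Fin (d + 1))) x
  have hφ : ContMDiffOn (𝓡 (d + 1)) (𝓡 (d + 1)) ∞ φ φ.source := contMDiffOn_chart
  have hφs : ContMDiffOn (𝓡 (d + 1)) (𝓡 (d + 1)) ∞ φ.symm φ.target := contMDiffOn_chart_symm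
  have hxφ : x ∈ φ.source := mem_chart_source _ x
  have hv : ContDiffOn ℝ ∞ (u ∘ φ.symm) φ.target := (hu.comp_contMDiffOn hφs).contDiffOn
  have hd : HasFDerivAt (u ∘ φ.symm) (fderiv ℝ (u ∘ φ.symm) (φ x)) (φ x) :=
    ((hv.contDiffAt (φ.open_target.mem_nhds (φ.map_source hxφ))).differentiableAt
      (by simp)).hasFDerivAt
  set l := fderiv ℝ (u ∘ φ.symm) (φ x) with hl
  have hl0 : l ≠ 0 := by
    intro h0
    apply hx
    have h1 : MDifferentiableAt (𝓡 (d + 1)) (𝓡 (d + 1)) φ x :=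
      (hφ.contMDiffAt (φ.open_source.mem_nhds hxφ)).mdifferentiableAt (by simp)
    have h2 := hd.hasMFDerivAt.comp x h1.hasMFDerivAt
    have h3 : u =ᶠ[nhds x] (u ∘ φ.symm) ∘ φ := by
      filter_upwards [φ.open_source.mem_nhds hxφ] with z hz
      simp [φ.left_inv hz]
    rw [h3.mfderiv_eq, h2.mfderiv, h0]
    exact ContinuousLinearMap.zero_comp _
  obtain ⟨A, hA⟩ := exists_equiv_apply_zero_eq hl0
  -- The first coordinate of A z is l z, so the correction makes that of F equal to u in the chart.
  -- The correction has zero derivative at φ x, so F has derivative A there.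
  let F : EuclideanSpace ℝ (Fin (d + 1)) → EuclideanSpace ℝ (Fin (d + 1)) :=
    fun z => A z + ((u ∘ φ.symm) z - l z) • EuclideanSpace.single 0 1
  have hF : ContDiffOn ℝ ∞ F φ.target :=
    A.contDiff.contDiffOn.add ((hv.sub l.contDiff.contDiffOn).smul contDiffOn_const)
  have hFA : HasFDerivAt F (A : EuclideanSpace ℝ (Fin (d + 1)) →L[ℝ] _) (φ x) := by
    have := A.hasFDerivAt (x := φ x) |>.add ((hd.sub l.hasFDerivAt).smul_const
      (EuclideanSpace.single (0 : Fin (d + 1)) (1 : ℝ)))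
    rw [sub_self, ContinuousLinearMap.zero_smulRight, add_zero] at this
    exact this
  obtain ⟨P, haP, hPU, hPF, hPs⟩ := exists_openPartialHomeomorph_contDiffOn φ.open_target hF
    (φ.map_source hxφ) hFA
  refine ⟨φ.trans P, ?_, ?_, ?_, ?_⟩
  · rw [φ.trans_source]
    exact ⟨hxφ, haP⟩
  · rw [φ.trans_source, φ.coe_trans, hPF]
    exact (hF.contMDiffOn.mono hPU).comp (hφ.mono inter_subset_left) fun z hz => hz.2
  · rw [φ.trans_target]
    exact hφs.comp (hPs.contMDiffOn.mono inter_subset_left) fun z hz => hz.2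
  · intro z hz
    rw [φ.trans_source] at hz
    simp [hPF, F, hA, φ.left_inv hz.1]

end AdaptedChart

/-! ### The gradient and the densities in an adapted chart -/

section AdaptedGram

variable {d : ℕ} {X : Type*} [TopologicalSpace X]
  [ChartedSpace (EuclideanSpace ℝ (Fin (d + 1))) X] [IsManifold (𝓡 (d + 1)) ∞ X]

theorem inner_gradient (g : RMetric (d + 1) X) (u : X → ℝ) (x : X)
    (w : TangentSpace (𝓡 (d + 1)) x) :
    g.inner x (gradient g u x) w = mfderiv (𝓡 (d + 1)) 𝓘(ℝ, ℝ) u x w :=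
  LinearMap.BilinForm.apply_toDual_symm_apply
    (hB := metricForm_nondegenerate g x) (mfderiv (𝓡 (d + 1)) 𝓘(ℝ, ℝ) u x).toLinearMap w

theorem inner_self_nonneg' (g : RMetric (d + 1) X) (x : X) (v : TangentSpace (𝓡 (d + 1)) x) :
    0 ≤ g.inner x v v := by
  by_cases h : v = 0
  · simp [h]
  · exact (g.pos x v h).le

theorem gradientNorm_pos (g : RMetric (d + 1) X) {u : X → ℝ} {x : X}
    (hx : mfderiv (𝓡 (d + 1)) 𝓘(ℝ, ℝ) u x ≠ 0) : 0 < gradientNorm g u x := by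
  refine Real.sqrt_pos.2 (g.pos x _ fun h => hx ?_)
  ext w
  rw [← inner_gradient g, h, map_zero]
  rfl

variable {u : X → ℝ} {e : OpenPartialHomeomorph X (EuclideanSpace ℝ (Fin (d + 1)))}

theorem IsAdaptedChart.mdifferentiableAt_symm (he : IsAdaptedChart u e)
    {z : EuclideanSpace ℝ (Fin (d + 1))} (hz : z ∈ e.target) :
    MDifferentiableAt (𝓡 (d + 1)) (𝓡 (d + 1)) e.symm z :=
  (he.smooth_symm.contMDiffAt (e.open_target.mem_nhds hz)).mdifferentiableAt (by simp)

theorem IsAdaptedChart.injective_modelDeriv (he : IsAdaptedChart u e)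
    {z : EuclideanSpace ℝ (Fin (d + 1))} (hz : z ∈ e.target) :
    Function.Injective (modelDeriv (n := d + 1) e.symm z) := by
  have h1 : MDifferentiableAt (𝓡 (d + 1)) (𝓡 (d + 1)) e (e.symm z) :=
    (he.smooth.contMDiffAt (e.open_source.mem_nhds (e.map_target hz))).mdifferentiableAt (by simp)
  have h2 := h1.hasMFDerivAt.comp z (he.mdifferentiableAt_symm hz).hasMFDerivAt
  have h3 : e ∘ e.symm =ᶠ[nhds z] id := by
    filter_upwards [e.open_target.mem_nhds hz] with y hy using e.right_inv hy
  have h4 := h2.mfderiv.symm.trans (h3.mfderiv_eq.trans mfderiv_id)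
  intro v w hvw
  have h5 : ∀ v, mfderiv (𝓡 (d + 1)) (𝓡 (d + 1)) e (e.symm z) (modelDeriv (n := d + 1) e.symm z v)
      = v := fun v => DFunLike.congr_fun h4 v
  rw [← h5 v, ← h5 w, hvw]

theorem IsAdaptedChart.symm_apply_zero (he : IsAdaptedChart u e)
    {z : EuclideanSpace ℝ (Fin (d + 1))} (hz : z ∈ e.target) : u (e.symm z) = z 0 := by
  rw [← he.apply_zero _ (e.map_target hz), e.right_inv hz]

theorem IsAdaptedChart.mfderiv_modelDeriv (he : IsAdaptedChart u e)
    (hu : ContMDiff (𝓡 (d + 1)) 𝓘(ℝ, ℝ) ∞ u)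
    {z : EuclideanSpace ℝ (Fin (d + 1))} (hz : z ∈ e.target) (w : EuclideanSpace ℝ (Fin (d + 1))) :
    mfderiv (𝓡 (d + 1)) 𝓘(ℝ, ℝ) u (e.symm z) (modelDeriv (n := d + 1) e.symm z w) = w 0 := by
  have h1 := (hu.mdifferentiableAt (by simp) (x := e.symm z)).hasMFDerivAt.comp z
    (he.mdifferentiableAt_symm hz).hasMFDerivAt
  have h3 : u ∘ e.symm =ᶠ[nhds z] EuclideanSpace.proj (𝕜 := ℝ) (0 : Fin (d + 1)) := by
    filter_upwards [e.open_target.mem_nhds hz] with y hy using he.symm_apply_zero hy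
  have h4 := h1.mfderiv.symm.trans (h3.mfderiv_eq.trans
    (EuclideanSpace.proj (𝕜 := ℝ) (0 : Fin (d + 1))).hasFDerivAt.hasMFDerivAt.mfderiv)
  exact DFunLike.congr_fun h4 w

/-- The squared length of the gradient in adapted coordinates. -/
theorem IsAdaptedChart.det_gramMatrix_mul (he : IsAdaptedChart u e) (g : RMetric (d + 1) X)
    (hu : ContMDiff (𝓡 (d + 1)) 𝓘(ℝ, ℝ) ∞ u)
    {z : EuclideanSpace ℝ (Fin (d + 1))} (hz : z ∈ e.target) :
    (gramMatrix g e.symm z).det * g.inner (e.symm z) (gradient g u (e.symm z))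
      (gradient g u (e.symm z)) = ((gramMatrix g e.symm z).submatrix Fin.succ Fin.succ).det := by
  set L := modelDeriv (n := d + 1) e.symm z with hL
  set G := gramMatrix g e.symm z with hG
  let v : EuclideanSpace ℝ (Fin (d + 1)) := gradient g u (e.symm z)
  have hsurj : Function.Surjective L :=
    LinearMap.surjective_of_injective (f := L.toLinearMap) (he.injective_modelDeriv hz)
  obtain ⟨c, hc⟩ := hsurj v
  -- The entries of Gc are g(∂ᵢ, ∇u) = du(∂ᵢ), and u is coordinate 0.
  have hGc : G.mulVec c = Pi.single 0 1 := by
    ext i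
    have h1 : G.mulVec c i = modelForm g (e.symm z) (L (EuclideanSpace.single i 1)) (L c) := by
      conv_rhs => rw [euclideanSpace_eq_sum_single c]
      simp [Matrix.mulVec, dotProduct, hG, gramMatrix, hL, mul_comm]
    rw [h1, hc]
    have h2 : modelForm g (e.symm z) (L (EuclideanSpace.single i 1)) v =
        mfderiv (𝓡 (d + 1)) 𝓘(ℝ, ℝ) u (e.symm z) (L (EuclideanSpace.single i 1)) :=
      (g.symm _ _ _).trans (inner_gradient g u (e.symm z) _)
    rw [h2, he.mfderiv_modelDeriv hu hz]
    simp [Pi.single_apply, eq_comm]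
  have hc0 : g.inner (e.symm z) (gradient g u (e.symm z)) (gradient g u (e.symm z)) = c 0 := by
    rw [inner_gradient, ← he.mfderiv_modelDeriv hu hz c]
    exact congrArg _ hc.symm
  -- Cramer's rule: entry 0 of det G · c = adj(G) e₀, where c 0 = |∇u|².
  have h := congrArg (fun w => w 0) (congrArg (G.adjugate.mulVec) hGc)
  simp only [Matrix.mulVec_mulVec, Matrix.adjugate_mul, Matrix.smul_mulVec, Matrix.one_mulVec,
    Pi.smul_apply, smul_eq_mul, Matrix.mulVec_single_one, Matrix.col_apply] at h
  rw [hc0, h, Matrix.adjugate_fin_succ_eq_det_submatrix]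
  simp [Fin.succAbove_zero]

/-- A null vector of the Gram matrix would give a tangent vector of zero length, nonzero because the
chart is an immersion. -/
theorem IsAdaptedChart.det_gramMatrix_ne_zero (he : IsAdaptedChart u e) (g : RMetric (d + 1) X)
    {z : EuclideanSpace ℝ (Fin (d + 1))} (hz : z ∈ e.target) :
    (gramMatrix g e.symm z).det ≠ 0 := by
  intro h
  obtain ⟨c, hc0, hc⟩ := Matrix.exists_mulVec_eq_zero_iff.2 h
  have h1 := form_comp_apply (modelForm g (e.symm z)) (modelDeriv (n := d + 1) e.symm z)
    (modelDeriv (n := d + 1) e.symm z) (WithLp.toLp 2 c) (WithLp.toLp 2 c)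
  have h2 : c ⬝ᵥ (gramMatrix g e.symm z).mulVec c = 0 := by rw [hc]; simp
  have h3 : modelForm g (e.symm z) (modelDeriv (n := d + 1) e.symm z (WithLp.toLp 2 c))
      (modelDeriv (n := d + 1) e.symm z (WithLp.toLp 2 c)) = 0 := by
    rw [h1, ← h2]
    simp only [dotProduct, Matrix.mulVec, Finset.mul_sum, gramMatrix, Matrix.of_apply]
    exact Finset.sum_congr rfl fun a _ => Finset.sum_congr rfl fun b _ => by ring
  refine (g.pos (e.symm z) (modelDeriv (n := d + 1) e.symm z (WithLp.toLp 2 c)) fun h4 => ?_).ne' h3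
  apply hc0
  have := he.injective_modelDeriv hz (h4.trans (map_zero _).symm)
  simpa using this

/-- The gradient of a function without critical points has continuous length. -/
theorem continuous_gradientNorm (g : RMetric (d + 1) X) (hu : ContMDiff (𝓡 (d + 1)) 𝓘(ℝ, ℝ) ∞ u)
    (hu' : ∀ x, mfderiv (𝓡 (d + 1)) 𝓘(ℝ, ℝ) u x ≠ 0) : Continuous (gradientNorm g u) := by
  rw [continuous_iff_continuousAt]
  intro x
  obtain ⟨e, hx, he⟩ := exists_isAdaptedChart hu (hu' x)
  suffices h : ContinuousOn (gradientNorm g u) e.source from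
    h.continuousAt (e.open_source.mem_nhds hx)
  have hG := continuousOn_gramMatrix g e.open_target he.smooth_symm
  -- On the chart |∇u|² is the minor divided by det G, both continuous.
  have h1 : ContinuousOn (fun z => √(((gramMatrix g e.symm z).submatrix Fin.succ Fin.succ).det /
      (gramMatrix g e.symm z).det)) e.target := by
    refine ContinuousOn.sqrt (ContinuousOn.div ?_ ?_ fun z hz => he.det_gramMatrix_ne_zero g hz)
    · exact (Continuous.comp_continuousOn (by fun_prop : Continuous
        fun M : Matrix (Fin (d + 1)) (Fin (d + 1)) ℝ => (M.submatrix Fin.succ Fin.succ).det) hG :)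
    · exact (Continuous.comp_continuousOn (by fun_prop : Continuous
        fun M : Matrix (Fin (d + 1)) (Fin (d + 1)) ℝ => M.det) hG :)
  refine (h1.comp e.continuousOn fun y hy => e.map_source hy).congr fun y hy => ?_
  have h2 := he.det_gramMatrix_mul g hu (e.map_source hy)
  have h3 := he.det_gramMatrix_ne_zero g (e.map_source hy)
  rw [e.left_inv hy] at h2
  simp only [Function.comp]
  rw [← h2, mul_div_cancel_left₀ _ h3]
  rfl

theorem IsAdaptedChart.modelDeriv_slice (he : IsAdaptedChart u e) {l : ℝ}
    {y : EuclideanSpace ℝ (Fin d)} (hy : consPoint l y ∈ e.target) :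
    modelDeriv (n := d + 1) (e.symm ∘ consPoint l) y =
      (modelDeriv (n := d + 1) e.symm (consPoint l y)).comp (inclZero d) :=
  ((he.mdifferentiableAt_symm hy).hasMFDerivAt.comp y
    (hasFDerivAt_consPoint l y).hasMFDerivAt).mfderiv

/-- The volume densities of an adapted chart and of its slices. -/
theorem IsAdaptedChart.gramDensity_slice (he : IsAdaptedChart u e) (g : RMetric (d + 1) X)
    (hu : ContMDiff (𝓡 (d + 1)) 𝓘(ℝ, ℝ) ∞ u) {l : ℝ}
    {y : EuclideanSpace ℝ (Fin d)} (hy : consPoint l y ∈ e.target) :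
    gramDensity g (e.symm ∘ consPoint l) y = gramDensity g e.symm (consPoint l y) *
      gradientNorm g u (e.symm (consPoint l y)) := by
  -- The slice has the coordinate fields ∂₁, …, ∂_d of the chart, without ∂₀.
  have h : gramMatrix g (e.symm ∘ consPoint l) y =
      (gramMatrix g e.symm (consPoint l y)).submatrix Fin.succ Fin.succ := by
    ext i j
    simp [gramMatrix, he.modelDeriv_slice hy, inclZero_single]
  rw [gramDensity_eq, h, ← he.det_gramMatrix_mul g hu hy,
    Real.sqrt_mul' _ (inner_self_nonneg' g _ _)]
  rfl

theorem IsAdaptedChart.isParametrization_symm (he : IsAdaptedChart u e) :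
    IsParametrization (n := d + 1) (univ : Set X) e.target e.symm where
  isOpen := e.open_target
  smooth := he.smooth_symm
  injOn := e.symm.injOn
  mapsTo := mapsTo_univ _ _
  immersion := fun _ hz => he.injective_modelDeriv hz

theorem IsAdaptedChart.isParametrization_slice (he : IsAdaptedChart u e) (l : ℝ) :
    IsParametrization (n := d + 1) {x | u x = l} (consPoint l ⁻¹' e.target)
      (e.symm ∘ consPoint l) where
  isOpen := e.open_target.preimage (contDiff_consPoint l).continuous
  smooth := he.smooth_symm.comp (contDiff_consPoint l).contMDiff.contMDiffOn fun _ hy => hy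
  injOn := fun y hy z hz h => by
    rw [← tailProj_consPoint l y, ← tailProj_consPoint l z, e.symm.injOn hy hz h]
  mapsTo := fun y hy => by
    simp [he.symm_apply_zero hy]
  immersion := fun y hy => by
    change Function.Injective (modelDeriv (n := d + 1) (e.symm ∘ consPoint l) y)
    rw [he.modelDeriv_slice hy]
    refine (he.injective_modelDeriv hy).comp fun v w h => ?_
    ext i
    exact congrArg (fun z : EuclideanSpace ℝ (Fin (d + 1)) => z i.succ) h

end AdaptedGram

/-! ### The coarea formula -/

section Coarea

variable {d : ℕ} {X : Type*} [TopologicalSpace X]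
  [ChartedSpace (EuclideanSpace ℝ (Fin (d + 1))) X] [IsManifold (𝓡 (d + 1)) ∞ X]
  [MeasurableSpace X] [BorelSpace X]

/-- The surface measure of the level set `{u = l}` with density `1 / |∇u|`. -/
def levelMeasure (g : RMetric (d + 1) X) (u : X → ℝ) (l : ℝ) : Measure X :=
  (riemannianMeasure g d {x | u x = l}).withDensity fun x =>
    ENNReal.ofReal (gradientNorm g u x)⁻¹

variable {u : X → ℝ} {e : OpenPartialHomeomorph X (EuclideanSpace ℝ (Fin (d + 1)))}

theorem measurable_inv_gradientNorm (g : RMetric (d + 1) X)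
    (hu : ContMDiff (𝓡 (d + 1)) 𝓘(ℝ, ℝ) ∞ u)
    (hu' : ∀ x, mfderiv (𝓡 (d + 1)) 𝓘(ℝ, ℝ) u x ≠ 0) :
    Measurable fun x => ENNReal.ofReal (gradientNorm g u x)⁻¹ :=
  ((continuous_gradientNorm g hu hu').inv₀
    fun x => (gradientNorm_pos g (hu' x)).ne').measurable.ennreal_ofReal

/-- Continuity of the density is known on `e.target` only; the cut-off makes it measurable on the
whole space, as Tonelli's theorem requires. -/
theorem measurable_indicator_gramDensity (he : IsAdaptedChart u e) (g : RMetric (d + 1) X)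
    {A : Set X} (hA : MeasurableSet A) :
    Measurable ((e.target ∩ e.symm ⁻¹' A).indicator
      fun z => ENNReal.ofReal (gramDensity g e.symm z)) := by
  have h := (continuousOn_gramDensity g e.open_target he.smooth_symm)
  have hB : MeasurableSet (e.target ∩ e.symm ⁻¹' A) :=
    measurableSet_inter_preimage e.open_target.measurableSet e.continuousOn_symm hA
  classical
  rw [← piecewise_eq_indicator]
  exact ContinuousOn.measurable_piecewise (ENNReal.continuous_ofReal.comp_continuousOn
    (h.mono inter_subset_left)) continuousOn_const hB

theorem IsAdaptedChart.riemannianVolume_apply (he : IsAdaptedChart u e) (g : RMetric (d + 1) X)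
    {A : Set X} (hA : MeasurableSet A) (hAe : A ⊆ e.source) :
    riemannianVolume g A = ∫⁻ z, (e.target ∩ e.symm ⁻¹' A).indicator
      (fun z => ENNReal.ofReal (gramDensity g e.symm z)) z := by
  have h := riemannianMeasure_restrict g e.open_source he.isParametrization_symm he.smooth
    (fun x hx => e.map_source hx.2) (fun x hx => e.left_inv hx.2)
  rw [lintegral_indicator (measurableSet_inter_preimage e.open_target.measurableSet
      e.continuousOn_symm hA),
    ← map_gramDensity_apply g e.open_target e.continuousOn_symm hA]
  have h' := congrArg (fun μ => μ A) h
  simpa only [riemannianVolume, Measure.restrict_apply hA, inter_eq_left.2 hAe] using h'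

/-- The slice of the chart parametrizes the level set, with inverse the last d coordinates of e. Its
density has a factor |∇u|, which the weight 1/|∇u| cancels; what remains is the integrand of
`IsAdaptedChart.riemannianVolume_apply` on the slice. -/
theorem IsAdaptedChart.levelMeasure_apply (he : IsAdaptedChart u e) (g : RMetric (d + 1) X)
    (hu : ContMDiff (𝓡 (d + 1)) 𝓘(ℝ, ℝ) ∞ u)
    (hu' : ∀ x, mfderiv (𝓡 (d + 1)) 𝓘(ℝ, ℝ) u x ≠ 0)
    {A : Set X} (hA : MeasurableSet A) (hAe : A ⊆ e.source) (l : ℝ) :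
    levelMeasure g u l A = ∫⁻ y, (e.target ∩ e.symm ⁻¹' A).indicator
      (fun z => ENNReal.ofReal (gramDensity g e.symm z)) (consPoint l y) := by
  have hp := he.isParametrization_slice l
  have h := riemannianMeasure_restrict g e.open_source hp
    ((tailProj d).contDiff.contMDiff.comp_contMDiffOn he.smooth)
    (fun x hx => by
      have : consPoint l (tailProj d (e x)) = e x := by
        rw [← (he.apply_zero x hx.2).trans hx.1, consPoint_tailProj]
      simpa [this] using e.map_source hx.2)
    (fun x hx => by
      have : consPoint l (tailProj d (e x)) = e x := by
        rw [← (he.apply_zero x hx.2).trans hx.1, consPoint_tailProj]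
      simp [this, e.left_inv hx.2])
  set V := consPoint l ⁻¹' e.target with hV
  set ψ := e.symm ∘ consPoint l with hψ
  have hρ := measurable_inv_gradientNorm g hu hu'
  have hm : AEMeasurable ψ (volume.restrict V) :=
    hp.smooth.continuousOn.aemeasurable hp.isOpen.measurableSet
  have hm' := hm.mono_ac (withDensity_absolutelyContinuous (volume.restrict V)
    fun y => ENNReal.ofReal (gramDensity g ψ y))
  have hd : AEMeasurable (fun y => ENNReal.ofReal (gramDensity g ψ y)) (volume.restrict V) :=
    ((continuousOn_gramDensity g hp.isOpen hp.smooth).aemeasurable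
      hp.isOpen.measurableSet).ennreal_ofReal
  unfold levelMeasure
  rw [withDensity_apply _ hA, ← inter_eq_left.2 hAe, ← Measure.restrict_restrict hA, h,
    Measure.restrict_restrict hA, inter_eq_left.2 hAe, ← lintegral_indicator hA,
    lintegral_map' (hρ.indicator hA).aemeasurable hm',
    lintegral_withDensity_eq_lintegral_mul₀ hd
      (g := fun y => A.indicator (fun x => ENNReal.ofReal (gradientNorm g u x)⁻¹) (ψ y))
      ((hρ.indicator hA).comp_aemeasurable hm),
    ← lintegral_indicator hp.isOpen.measurableSet]
  refine lintegral_congr fun y => ?_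
  by_cases hy : consPoint l y ∈ e.target
  · rw [indicator_of_mem (show y ∈ V from hy)]
    by_cases hyA : e.symm (consPoint l y) ∈ A
    · rw [indicator_of_mem (show consPoint l y ∈ e.target ∩ e.symm ⁻¹' A from ⟨hy, hyA⟩),
        Pi.mul_apply, indicator_of_mem (show ψ y ∈ A from hyA), he.gramDensity_slice g hu hy]
      have hpos := gradientNorm_pos g (hu' (e.symm (consPoint l y)))
      rw [← ENNReal.ofReal_mul' (inv_nonneg.2 (show 0 ≤ gradientNorm g u (ψ y) from hpos.le))]
      congr 1
      exact mul_inv_cancel_right₀ hpos.ne' _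
    · rw [indicator_of_notMem (fun h => hyA h.2), Pi.mul_apply,
        indicator_of_notMem (show ψ y ∉ A from hyA), mul_zero]
  · rw [indicator_of_notMem (show y ∉ V from hy), indicator_of_notMem (fun h => hy h.1)]

/-- The coarea formula on the domain of an adapted chart. -/
theorem IsAdaptedChart.coarea (he : IsAdaptedChart u e) (g : RMetric (d + 1) X)
    (hu : ContMDiff (𝓡 (d + 1)) 𝓘(ℝ, ℝ) ∞ u)
    (hu' : ∀ x, mfderiv (𝓡 (d + 1)) 𝓘(ℝ, ℝ) u x ≠ 0)
    {A : Set X} (hA : MeasurableSet A) (hAe : A ⊆ e.source) :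
    Measurable (fun l => levelMeasure g u l A) ∧
      ∫⁻ l, levelMeasure g u l A = riemannianVolume g A := by
  have hG := measurable_indicator_gramDensity he g hA
  have hc := measurePreserving_consPoint (d := d)
  have hGc := hG.comp hc.measurable
  simp_rw [he.levelMeasure_apply g hu hu' hA hAe]
  refine ⟨hGc.lintegral_prod_right', ?_⟩
  rw [he.riemannianVolume_apply g hA hAe, ← hc.lintegral_comp hG]
  exact (lintegral_prod _ hGc.aemeasurable).symm

/-- The coarea formula for measurable sets. -/
theorem coarea_apply [SecondCountableTopology X] (g : RMetric (d + 1) X)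
    (hu : ContMDiff (𝓡 (d + 1)) 𝓘(ℝ, ℝ) ∞ u)
    (hu' : ∀ x, mfderiv (𝓡 (d + 1)) 𝓘(ℝ, ℝ) u x ≠ 0) {A : Set X} (hA : MeasurableSet A) :
    Measurable (fun l => levelMeasure g u l A) ∧
      ∫⁻ l, levelMeasure g u l A = riemannianVolume g A := by
  rcases isEmpty_or_nonempty X with hX | hX
  · simp [eq_empty_of_isEmpty A]
  choose e hxe he using fun x => exists_isAdaptedChart hu (hu' x)
  obtain ⟨s, hs, hsU⟩ := TopologicalSpace.countable_cover_nhds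
    fun x => (e x).open_source.mem_nhds (hxe x)
  have hsne : s.Nonempty := by
    by_contra h
    rw [not_nonempty_iff_eq_empty] at h
    exact empty_ne_univ (by simpa [h] using hsU)
  obtain ⟨c, rfl⟩ := hs.exists_eq_range hsne
  rw [biUnion_range] at hsU
  -- Disjoint pieces of the chart domains, so that countable additivity reduces the claim to single
  -- charts.
  let D : ℕ → Set X := disjointed fun i => (e (c i)).source
  have hDm : ∀ i, MeasurableSet (D i) :=
    MeasurableSet.disjointed fun i => (e (c i)).open_source.measurableSet
  have hAD : A = ⋃ i, A ∩ D i := by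
    rw [← inter_iUnion, iUnion_disjointed, hsU, inter_univ]
  have hpiece := fun i => (he (c i)).coarea g hu hu' (hA.inter (hDm i))
    (inter_subset_right.trans (disjointed_subset _ i))
  have hsum : ∀ μ : Measure X, μ A = ∑' i, μ (A ∩ D i) := by
    intro μ
    conv_lhs => rw [hAD]
    exact measure_iUnion (fun i j hij => ((disjoint_disjointed _ hij).mono
      inter_subset_right inter_subset_right)) fun i => hA.inter (hDm i)
  simp_rw [hsum]
  refine ⟨Measurable.tsum fun i => (hpiece i).1, ?_⟩
  rw [lintegral_tsum fun i => (hpiece i).1.aemeasurable]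
  simp_rw [(hpiece _).2]

/-- The level measures of a function without critical points as a kernel. -/
def levelKernel [SecondCountableTopology X] (g : RMetric (d + 1) X)
    (hu : ContMDiff (𝓡 (d + 1)) 𝓘(ℝ, ℝ) ∞ u)
    (hu' : ∀ x, mfderiv (𝓡 (d + 1)) 𝓘(ℝ, ℝ) u x ≠ 0) : ProbabilityTheory.Kernel ℝ X where
  toFun := levelMeasure g u
  measurable' := Measure.measurable_of_measurable_coe _ fun _ hA => (coarea_apply g hu hu' hA).1

/-- The coarea formula. -/
theorem bind_levelKernel [SecondCountableTopology X] (g : RMetric (d + 1) X)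
    (hu : ContMDiff (𝓡 (d + 1)) 𝓘(ℝ, ℝ) ∞ u)
    (hu' : ∀ x, mfderiv (𝓡 (d + 1)) 𝓘(ℝ, ℝ) u x ≠ 0) :
    (volume : Measure ℝ).bind (levelKernel g hu hu') = riemannianVolume g := by
  ext A hA
  rw [Measure.bind_apply hA (levelKernel g hu hu').aemeasurable]
  exact (coarea_apply g hu hu' hA).2

/-- Riemannian measures of a set are concentrated on it. -/
theorem riemannianMeasure_compl {n k : ℕ} {X : Type*} [TopologicalSpace X]
    [ChartedSpace (EuclideanSpace ℝ (Fin n)) X] [IsManifold (𝓡 n) ∞ X]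
    [MeasurableSpace X] [BorelSpace X] (g : RMetric n X) {Z : Set X} (hZ : MeasurableSet Z) :
    riemannianMeasure g k Z Zᶜ = 0 := by
  -- Concentration is phrased as an inequality of measures, since this passes from the members of
  -- the family to their supremum.
  have h : riemannianMeasure g k Z ≤ (riemannianMeasure g k Z).restrict Z := by
    refine sSup_le fun μ hμ => ?_
    have hle : μ ≤ riemannianMeasure g k Z := le_sSup hμ
    obtain ⟨V, ψ, hψ, rfl⟩ := mem_ofPred.1 hμ
    refine le_trans (le_of_eq ?_) (Measure.restrict_mono le_rfl hle)
    refine (Measure.restrict_eq_self_of_ae_mem ?_).symm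
    rw [ae_iff]
    change Measure.map ψ _ Zᶜ = 0
    rw [map_gramDensity_apply g hψ.isOpen hψ.smooth.continuousOn hZ.compl]
    have : V ∩ ψ ⁻¹' Zᶜ = ∅ := by
      ext y
      simpa using fun hy => hψ.mapsTo hy
    rw [this, Measure.restrict_empty, lintegral_zero_measure]
  have := h Zᶜ
  rw [Measure.restrict_apply hZ.compl] at this
  simpa using this

end Coarea

/-! ### Integration over level sets -/

section Fubini

variable {d : ℕ} {X : Type*} [TopologicalSpace X]
  [ChartedSpace (EuclideanSpace ℝ (Fin (d + 1))) X] [IsManifold (𝓡 (d + 1)) ∞ X]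
  [MeasurableSpace X] [BorelSpace X] {𝕜 : Type*} [RCLike 𝕜] {u : X → ℝ}

theorem ae_levelMeasure (g : RMetric (d + 1) X) (hu : Continuous u) (l : ℝ) :
    ∀ᵐ x ∂(levelMeasure g u l), u x = l := by
  have hZ : MeasurableSet {x | u x = l} := (isClosed_eq hu continuous_const).measurableSet
  exact (withDensity_absolutelyContinuous _ _).ae_le
    (mem_ae_iff.2 (riemannianMeasure_compl (k := d) g hZ))

theorem toReal_smul_eq_div (g : RMetric (d + 1) X) (u : X → ℝ) (f : X → 𝕜) (x : X) :
    (ENNReal.ofReal (gradientNorm g u x)⁻¹).toReal • f x =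
      f x / ((gradientNorm g u x : ℝ) : 𝕜) := by
  rw [ENNReal.toReal_ofReal 
      (inv_nonneg.2 (show 0 ≤ gradientNorm g u x from Real.sqrt_nonneg _)), RCLike.real_smul_eq_coe_mul,
    div_eq_inv_mul, RCLike.ofReal_inv]

theorem integrable_levelMeasure_iff (g : RMetric (d + 1) X)
    (hu : ContMDiff (𝓡 (d + 1)) 𝓘(ℝ, ℝ) ∞ u)
    (hu' : ∀ x, mfderiv (𝓡 (d + 1)) 𝓘(ℝ, ℝ) u x ≠ 0) (f : X → 𝕜) (l : ℝ) :
    Integrable f (levelMeasure g u l) ↔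
      Integrable (fun x => f x / ((gradientNorm g u x : ℝ) : 𝕜))
        (riemannianMeasure g d {x | u x = l}) := by
  unfold levelMeasure
  rw [integrable_withDensity_iff_integrable_smul' (measurable_inv_gradientNorm g hu hu')
    (by simp)]
  simp_rw [toReal_smul_eq_div]

theorem integral_levelMeasure (g : RMetric (d + 1) X)
    (hu : ContMDiff (𝓡 (d + 1)) 𝓘(ℝ, ℝ) ∞ u)
    (hu' : ∀ x, mfderiv (𝓡 (d + 1)) 𝓘(ℝ, ℝ) u x ≠ 0) (f : X → 𝕜) (l : ℝ) :
    ∫ x, f x ∂(levelMeasure g u l) = ∫ x, f x / ((gradientNorm g u x : ℝ) : 𝕜)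
        ∂(riemannianMeasure g d {x | u x = l}) := by
  unfold levelMeasure
  rw [integral_withDensity_eq_integral_toReal_smul (measurable_inv_gradientNorm g hu hu')
    (by simp)]
  simp_rw [toReal_smul_eq_div]

/-- Integration over the level sets of `u`, weighted by a function of the level. -/
theorem integral_levelMeasure_mul [SecondCountableTopology X] (g : RMetric (d + 1) X)
    (hu : ContMDiff (𝓡 (d + 1)) 𝓘(ℝ, ℝ) ∞ u)
    (hu' : ∀ x, mfderiv (𝓡 (d + 1)) 𝓘(ℝ, ℝ) u x ≠ 0) {f : X → 𝕜} {q : ℝ → 𝕜}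
    (hf : Integrable (fun x => q (u x) * f x) (riemannianVolume g)) :
    Integrable (fun l => q l * ∫ x, f x ∂(levelMeasure g u l)) ∧
      ∫ l, q l * ∫ x, f x ∂(levelMeasure g u l) = ∫ x, q (u x) * f x ∂(riemannianVolume g) := by
  -- On the level set q(u) is the constant q l.
  have hl : ∀ l, ∫ x, q (u x) * f x ∂(levelMeasure g u l) =
      q l * ∫ x, f x ∂(levelMeasure g u l) := by
    intro l
    rw [← integral_const_mul]
    refine integral_congr_ae ?_
    filter_upwards [ae_levelMeasure g hu.continuous l] with x hx
    rw [hx]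
  -- With the volume written as a composition of the level kernel with a constant kernel, Fubini's
  -- theorem for kernel compositions applies.
  rw [← bind_levelKernel g hu hu', Measure.comp_eq_comp_const_apply] at hf ⊢
  refine ⟨?_, ?_⟩
  · have h := hf.integral_comp
    rw [ProbabilityTheory.Kernel.const_apply] at h
    exact h.congr (ae_of_all _ hl)
  · rw [ProbabilityTheory.Kernel.integral_comp hf, ProbabilityTheory.Kernel.const_apply]
    exact (integral_congr_ae (ae_of_all _ hl)).symm

end Fubini

/-! ### Reduction of the transform to level sets of θ -/

section Transform

variable {d : ℕ} {X : Type*} [TopologicalSpace X]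
  [ChartedSpace (EuclideanSpace ℝ (Fin (d + 1))) X] [IsManifold (𝓡 (d + 1)) ∞ X]
  {θ : X → Sph d → ℝ}

theorem mfderiv_sub_const {u : X → ℝ} (c : ℝ) {x : X}
    (hu : MDifferentiableAt (𝓡 (d + 1)) 𝓘(ℝ, ℝ) u x) :
    (mfderiv (𝓡 (d + 1)) 𝓘(ℝ, ℝ) (fun y => u y - c) x : EuclideanSpace ℝ (Fin (d + 1)) →L[ℝ] ℝ) =
      mfderiv (𝓡 (d + 1)) 𝓘(ℝ, ℝ) u x := by
  have h := (((hasFDerivAt_id (𝕜 := ℝ) (u x)).sub_const c).hasMFDerivAt.comp x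
    hu.hasMFDerivAt).mfderiv
  exact h

theorem gradientNorm_sub_const (g : RMetric (d + 1) X) {u : X → ℝ} (c : ℝ) {x : X}
    (hu : MDifferentiableAt (𝓡 (d + 1)) 𝓘(ℝ, ℝ) u x) :
    gradientNorm g (fun y => u y - c) x = gradientNorm g u x := by
  have h : gradient g (fun y => u y - c) x = gradient g u x :=
    congrArg (fun L : EuclideanSpace ℝ (Fin (d + 1)) →L[ℝ] ℝ =>
      ((metricForm g x).toDual (metricForm_nondegenerate g x)).symm L.toLinearMap)
      (mfderiv_sub_const c hu)
  unfold gradientNorm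
  rw [h]

theorem IsRegularResolved.contMDiff_left (hθ : IsRegularResolved θ) (w : Sph d) :
    ContMDiff (𝓡 (d + 1)) 𝓘(ℝ, ℝ) ∞ fun x => θ x w :=
  hθ.smooth.comp (contMDiff_id.prodMk contMDiff_const)

/-- The hypothesis concerns points of Z, but every x lies on the hypersurface with λ = θ(x, w). -/
theorem IsRegularResolved.mfderiv_ne_zero (hθ : IsRegularResolved θ) (w : Sph d) (x : X) :
    mfderiv (𝓡 (d + 1)) 𝓘(ℝ, ℝ) (fun x => θ x w) x ≠ 0 := by
  intro h
  refine hθ.dx_ne_zero x (θ x w, w) (sub_self _) ?_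
  exact (mfderiv_sub_const (θ x w) ((hθ.contMDiff_left w).mdifferentiableAt (by simp))).trans h

/-- Φ(·; l, w) and θ(·, w) differ by a constant, so they have the same gradient and the integrand
does not depend on l. -/
theorem IsRegularResolved.transformIntegrand_eq (hθ : IsRegularResolved θ) {𝕜 : Type*} [RCLike 𝕜]
    (g : RMetric (d + 1) X) (f : X → 𝕜) (l : ℝ) (w : Sph d) :
    transformIntegrand g θ f (l, w) =
      fun x => f x / ((gradientNorm g (fun x => θ x w) x : ℝ) : 𝕜) := by
  ext x
  unfold transformIntegrand
  congr 2
  exact gradientNorm_sub_const g l ((hθ.contMDiff_left w).mdifferentiableAt (by simp))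

theorem surfaceMeasure_eq [MeasurableSpace X] (g : RMetric (d + 1) X) (θ : X → Sph d → ℝ)
    (l : ℝ) (w : Sph d) :
    surfaceMeasure g θ (l, w) = riemannianMeasure g d {x | θ x w = l} := by
  have : hypersurface θ (l, w) = {x | θ x w = l} := by
    ext x
    exact sub_eq_zero
  rw [surfaceMeasure, this]

/-- A continuous multiple of an integrable function with compact essential support is
integrable. -/
theorem integrable_continuous_mul {Y 𝕜 : Type*} [TopologicalSpace Y] [MeasurableSpace Y]
    [OpensMeasurableSpace Y] [RCLike 𝕜] {μ : Measure Y} {f q : Y → 𝕜} (hf : Integrable f μ)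
    (hq : Continuous q) {K : Set Y} (hK : IsCompact K) (hfK : ∀ᵐ x ∂μ, x ∉ K → f x = 0) :
    Integrable (fun x => q x * f x) μ := by
  obtain ⟨C, hC⟩ := hK.exists_bound_of_continuousOn hq.continuousOn
  refine (hf.norm.const_mul C).mono' (hq.aestronglyMeasurable.mul hf.1) ?_
  filter_upwards [hfK] with x hx
  rw [norm_mul]
  by_cases hxK : x ∈ K
  · exact mul_le_mul_of_nonneg_right (hC x hxK) (norm_nonneg _)
  · simp [hx hxK]

end Transform

end MinkowskiFunk

end

/-! ### Polynomial moments of the transform -/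

open MinkowskiFunk

theorem mainTheorem11 {𝕜 : Type*} [RCLike 𝕜] {d : ℕ} (hd : 1 ≤ d)
    {X : Type*} [TopologicalSpace X] [T2Space X] [SecondCountableTopology X]
    [ChartedSpace (EuclideanSpace ℝ (Fin (d + 1))) X] [IsManifold (𝓡 (d + 1)) ∞ X]
    [MeasurableSpace X] [BorelSpace X]
    (g : MinkowskiFunk.RMetric (d + 1) X)
    (θ : X → MinkowskiFunk.Sph d → ℝ) (hθ : MinkowskiFunk.IsRegularResolved θ)
    (m : ℕ) (hm : ∀ x : X, MinkowskiFunk.IsSpherePolynomial m (θ x))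
    (f : X → 𝕜) (hf : Integrable f (MinkowskiFunk.riemannianVolume g))
    (hsupp : ∃ K : Set X, IsCompact K ∧
      ∀ᵐ x ∂(MinkowskiFunk.riemannianVolume g), x ∉ K → f x = 0)
    (k : ℕ) (p : Polynomial 𝕜) (hp : p.natDegree ≤ k) :
    (∀ w : MinkowskiFunk.Sph d,
      (∀ᵐ l : ℝ, Integrable (MinkowskiFunk.transformIntegrand g θ f (l, w))
        (MinkowskiFunk.surfaceMeasure g θ (l, w))) ∧
      Integrable (fun l : ℝ => p.eval (l : 𝕜) * MinkowskiFunk.transform g θ f (l, w))) ∧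
    MinkowskiFunk.IsSpherePolynomial (m * k) (fun w : MinkowskiFunk.Sph d =>
      ∫ l : ℝ, p.eval (l : 𝕜) * MinkowskiFunk.transform g θ f (l, w)) := by
  obtain ⟨K, hK, hfK⟩ := hsupp
  have hu := fun w => hθ.contMDiff_left w
  have hu' := fun w => hθ.mfderiv_ne_zero w
  have hF : ∀ w, Integrable (fun x => p.eval ((θ x w : ℝ) : 𝕜) * f x) (riemannianVolume g) :=
    fun w => integrable_continuous_mul hf
      (p.continuous.comp (RCLike.continuous_ofReal.comp (hu w).continuous)) hK hfK
  have htr : ∀ w l, transform g θ f (l, w) = ∫ x, f x ∂(levelMeasure g (fun x => θ x w) l) := by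
    intro w l
    rw [integral_levelMeasure g (hu w) (hu' w), transform, hθ.transformIntegrand_eq,
      surfaceMeasure_eq]
  have hmain := fun w => integral_levelMeasure_mul g (hu w) (hu' w)
    (q := fun l => p.eval ((l : ℝ) : 𝕜)) (hF w)
  simp_rw [htr]
  refine ⟨fun w => ⟨?_, (hmain w).1⟩, ?_⟩
  -- Absolute convergence comes from f itself and not from p(u) f, because p may vanish.
  · have hf' := hf
    rw [← bind_levelKernel g (hu w) (hu' w)] at hf'
    filter_upwards [Measure.ae_integrable_of_integrable_comp hf'] with l hl
    rw [hθ.transformIntegrand_eq, surfaceMeasure_eq]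
    exact (integrable_levelMeasure_iff g (hu w) (hu' w) f l).1 hl
  · have hw : (fun w : Sph d => ∫ l : ℝ, p.eval (l : 𝕜) *
        ∫ x, f x ∂(levelMeasure g (fun x => θ x w) l)) =
        fun w => ∫ x, p.eval ((θ x w : ℝ) : 𝕜) * f x ∂(riemannianVolume g) :=
      funext fun w => (hmain w).2
    rw [hw]
    -- For fixed x the integrand is the scalar f x times p(θ(x, ·)), a polynomial of degree at most
    -- mk on the sphere.
    refine isSpherePolynomial_integral (fun x => ?_) hF
    rw [← mem_spherePolynomials]
    have h := (spherePolynomials 𝕜 d (m * k)).smul_mem (f x)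
      (mem_spherePolynomials.2 ((hm x).polynomial_eval hp))
    convert h using 1
    ext w
    simp [mul_comm]
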